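/- A subset $D$ of a poset is directed if it is nonempty and every finite subset of $D$ has an upper bound in $D$. For a $T_0$ space $X$ let $\le$ be its specialization order, i.e. $x \le y$ if and only if $x \in \overline{\{y\}}$, and let $\mathord{\uparrow} x = \{y \in X \mid x \le y\}$. A $T_0$ space $X$ is called a strong $d$-space if for every directed subset $D$ of $X$ (with respect to $\le$), every $x \in X$ and every open set $U \subseteq X$, the inclusion $\bigcap_{d \in D} \mathord{\uparrow} d \cap \mathord{\uparrow} x \subseteq U$ implies $\mathord{\uparrow} d \cap \mathord{\uparrow} x \subseteq U$ for some $d \in D$. Let $\mathbf{Top}_0$ be the category of all $T_0$ spaces and continuous maps, and let $\mathbf{S}\text{-}\mathbf{Top}_d$ be its full subcategory of strong $d$-spaces. A full subcategory is called reflective if its inclusion functor has a left adjoint. Theorem. $\mathbf{S}\text{-}\mathbf{Top}_d$ is not a reflective subcategory of $\mathbf{Top}_0$. -/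

import Mathlib

open CategoryTheory Topology

universe u v

/-- The specialization order of a topological space: `x ≤ y` iff `x` lies in the closure of `{y}`.
(Mathlib writes this as `y ⤳ x`.) -/
def SpecLE {X : Type u} [TopologicalSpace X] (x y : X) : Prop :=
  x ∈ closure ({y} : Set X)

theorem specLE_iff_specializes {X : Type u} [TopologicalSpace X] {x y : X} :
    SpecLE x y ↔ y ⤳ x :=
  specializes_iff_mem_closure.symm

/-- The principal filter `↑ x = {y | x ≤ y}` in the specialization order. -/
def specUpper {X : Type u} [TopologicalSpace X] (x : X) : Set X :=
  {y | SpecLE x y}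

/-- A strong `d`-space: a `T₀` space such that for every (nonempty) directed subset `D` in the
specialization order, every point `x` and every open set `U`, if `(⋂ d ∈ D, ↑ d) ∩ ↑ x ⊆ U` then
`↑ d ∩ ↑ x ⊆ U` for some `d ∈ D`. -/
structure IsStrongDSpace (X : Type u) [TopologicalSpace X] : Prop where
  t0 : T0Space X
  exists_inter_subset : ∀ D : Set X, D.Nonempty → DirectedOn SpecLE D → ∀ (x : X) (U : Set X),
    IsOpen U → (⋂ d ∈ D, specUpper d) ∩ specUpper x ⊆ U → ∃ d ∈ D, specUpper d ∩ specUpper x ⊆ U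

/-- The property of being a `T₀` space, on objects of the category of topological spaces. -/
def isT0 : ObjectProperty TopCat.{u} := fun X => T0Space X

/-- The category of `T₀` spaces and continuous maps. -/
abbrev Top0 : Type (u + 1) := isT0.{u}.FullSubcategory

/-- The property of being a strong `d`-space, on objects of the category of `T₀` spaces.
The category of strong `d`-spaces is the full subcategory of `Top0` that it defines. -/
def isStrongD : ObjectProperty Top0.{u} := fun X => IsStrongDSpace X.obj

/-- The full subcategory of `C` on the objects satisfying `P` is reflective if the inclusion functor
into `C` has a left adjoint. -/
def IsReflectiveSubcategory {C : Type u} [Category.{v} C] (P : ObjectProperty C) : Prop :=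
  P.ι.IsRightAdjoint

/-! The obstruction is a single point. In the strong `d`-space `CombSpace`, `y ⊤` is the only common
upper bound of `x` and all finite `d n`; let `W` be `CombSpace` without it. For a universal map `η :
W → R`, the inclusion of `W` extends to `f : R → CombSpace`. Uniqueness of extensions keeps `y ⊤`
out of the range of `f`, since two open sets differing only at `y ⊤` have the same trace on `W`. So
in `R` the points `η x` and all `η (d n)` have no common upper bound, although each pair `η x`, `η
(d n)` lies below `η (y n)`: `R` is not a strong `d`-space. -/

/-- In a reflective subcategory of strong `d`-spaces, every `T₀` space has a universal continuous
map to a strong `d`-space. -/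
theorem exists_universal_map (h : IsReflectiveSubcategory isStrongD.{u}) (W : Type u)
    [TopologicalSpace W] [T0Space W] :
    ∃ (R : Type u) (_ : TopologicalSpace R) (η : W → R), IsStrongDSpace R ∧ Continuous η ∧
      ∀ (A : Type u) [TopologicalSpace A], IsStrongDSpace A →
        (∀ g : W → A, Continuous g → ∃ f : R → A, Continuous f ∧ f ∘ η = g) ∧
        ∀ f₁ f₂ : R → A, Continuous f₁ → Continuous f₂ → f₁ ∘ η = f₂ ∘ η → f₁ = f₂ := by
  have : (isStrongD.{u}).ι.IsRightAdjoint := h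
  let adj := Adjunction.ofIsRightAdjoint isStrongD.{u}.ι
  let W₀ : Top0.{u} := ⟨TopCat.of W, ‹T0Space W›⟩
  let η := adj.unit.app W₀
  refine ⟨_, ((isStrongD.{u}.ι.leftAdjoint).obj W₀).obj.obj.str, η.hom,
    ((isStrongD.{u}.ι.leftAdjoint).obj W₀).property, η.hom.hom.continuous, ?_⟩
  intro A _ hA
  let A₀ : isStrongD.{u}.FullSubcategory := ⟨⟨TopCat.of A, hA.t0⟩, hA⟩
  refine ⟨fun g hg => ?_, fun f₁ f₂ h₁ h₂ h₁₂ => ?_⟩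
  · let g₀ : W₀ ⟶ isStrongD.{u}.ι.obj A₀ := ObjectProperty.homMk (TopCat.ofHom ⟨g, hg⟩)
    let f := (adj.homEquiv W₀ A₀).symm g₀
    have hf : η ≫ isStrongD.{u}.ι.map f = g₀ := by
      exact (adj.homEquiv_unit W₀ A₀ f).symm.trans (Equiv.apply_symm_apply _ _)
    refine ⟨f.hom.hom, f.hom.hom.hom.continuous, ?_⟩
    have := congrArg (fun k : W₀ ⟶ isStrongD.{u}.ι.obj A₀ => (k.hom : W → A)) hf
    exact this
  · let k (f : _ → A) (hf : Continuous f) : (isStrongD.{u}.ι.leftAdjoint).obj W₀ ⟶ A₀ :=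
      ObjectProperty.homMk (ObjectProperty.homMk (TopCat.ofHom ⟨f, hf⟩))
    have hk : k f₁ h₁ = k f₂ h₂ := by
      apply (adj.homEquiv W₀ A₀).injective
      rw [Adjunction.homEquiv_unit, Adjunction.homEquiv_unit]
      apply ObjectProperty.hom_ext
      apply TopCat.hom_ext
      apply ContinuousMap.ext
      exact fun w => congrFun h₁₂ w
    have := congrArg (fun k : (isStrongD.{u}.ι.leftAdjoint).obj W₀ ⟶ A₀ =>
      (k.hom.hom : _ → A)) hk
    exact this

theorem specLE_iff_forall_isOpen {X : Type u} [TopologicalSpace X] {p q : X} :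
    SpecLE p q ↔ ∀ U : Set X, IsOpen U → p ∈ U → q ∈ U := by
  rw [specLE_iff_specializes, specializes_iff_forall_open]

theorem SpecLE.map {X Y : Type u} [TopologicalSpace X] [TopologicalSpace Y] {f : X → Y}
    (hf : Continuous f) {p q : X} (h : SpecLE p q) : SpecLE (f p) (f q) :=
  specLE_iff_specializes.2 ((specLE_iff_specializes.1 h).map hf)

theorem SpecLE.trans {X : Type u} [TopologicalSpace X] {p q r : X}
    (h : SpecLE p q) (h' : SpecLE q r) : SpecLE p r :=
  specLE_iff_forall_isOpen.2 fun U hU hp =>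
    specLE_iff_forall_isOpen.1 h' U hU (specLE_iff_forall_isOpen.1 h U hU hp)

/-! ### The comb space and its specialization order -/

/-- An increasing sequence `d 0 ≤ d 1 ≤ ⋯` with supremum `d ⊤`, a point `x`, and points `y n` such
that `y n` is a maximal common upper bound of `x` and `d n`. -/
inductive CombSpace : Type u
  | d (n : ℕ∞)
  | x
  | y (n : ℕ∞)

namespace CombSpace

/-- The open sets are the upper sets that are inaccessible by the supremum `d ⊤` of the `d n` and by
the limit `y ⊤` of the `y n`. -/
instance : TopologicalSpace CombSpace.{u} where
  IsOpen U := (∀ m n, m ≤ n → d m ∈ U → d n ∈ U ∧ y n ∈ U) ∧ (x ∈ U → ∀ n, y n ∈ U) ∧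
    (d ⊤ ∈ U → ∃ N : ℕ, d N ∈ U) ∧ (y ⊤ ∈ U → ∃ N : ℕ, ∀ n : ℕ, N ≤ n → y n ∈ U)
  isOpen_univ := by simp
  isOpen_inter := by
    rintro U V ⟨u₁, u₂, u₃, u₄⟩ ⟨v₁, v₂, v₃, v₄⟩
    refine ⟨fun m n hmn h => ?_, fun h n => ⟨u₂ h.1 n, v₂ h.2 n⟩, fun h => ?_, fun h => ?_⟩
    · exact ⟨⟨(u₁ m n hmn h.1).1, (v₁ m n hmn h.2).1⟩, (u₁ m n hmn h.1).2, (v₁ m n hmn h.2).2⟩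
    · obtain ⟨M, hM⟩ := u₃ h.1
      obtain ⟨N, hN⟩ := v₃ h.2
      refine ⟨max M N, (u₁ M _ ?_ hM).1, (v₁ N _ ?_ hN).1⟩ <;> simp
    · obtain ⟨M, hM⟩ := u₄ h.1
      obtain ⟨N, hN⟩ := v₄ h.2
      exact ⟨max M N, fun n hn => ⟨hM n (by omega), hN n (by omega)⟩⟩
  isOpen_sUnion := by
    intro S hS
    refine ⟨?_, ?_, ?_, ?_⟩
    · rintro m n hmn ⟨U, hU, h⟩
      have := (hS U hU).1 m n hmn h
      exact ⟨⟨U, hU, this.1⟩, U, hU, this.2⟩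
    · rintro ⟨U, hU, h⟩ n
      exact ⟨U, hU, (hS U hU).2.1 h n⟩
    · rintro ⟨U, hU, h⟩
      obtain ⟨N, hN⟩ := (hS U hU).2.2.1 h
      exact ⟨N, U, hU, hN⟩
    · rintro ⟨U, hU, h⟩
      obtain ⟨N, hN⟩ := (hS U hU).2.2.2 h
      exact ⟨N, fun n hn => ⟨U, hU, hN n hn⟩⟩

theorem isOpen_iff {U : Set CombSpace.{u}} : IsOpen U ↔
    (∀ m n, m ≤ n → d m ∈ U → d n ∈ U ∧ y n ∈ U) ∧ (x ∈ U → ∀ n, y n ∈ U) ∧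
    (d ⊤ ∈ U → ∃ N : ℕ, d N ∈ U) ∧ (y ⊤ ∈ U → ∃ N : ℕ, ∀ n : ℕ, N ≤ n → y n ∈ U) :=
  Iff.rfl

/-- The explicit order on `CombSpace`. -/
def Le : CombSpace.{u} → CombSpace.{u} → Prop
  | d m, d n => m ≤ n
  | d m, y n => m ≤ n
  | x, x => True
  | x, y _ => True
  | y m, y n => m = n
  | _, _ => False

theorem isOpen_le_d (N : ℕ) : IsOpen {p : CombSpace.{u} | Le (d N) p} := by
  refine isOpen_iff.2 ⟨fun m n hmn h => ⟨le_trans h hmn, le_trans h hmn⟩, fun h => h.elim,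
    fun _ => ⟨N, le_refl (N : ℕ∞)⟩, fun _ => ⟨N, fun n hn => ?_⟩⟩
  exact (Nat.cast_le (α := ℕ∞)).2 hn

theorem isOpen_le_x : IsOpen {p : CombSpace.{u} | Le x p} :=
  isOpen_iff.2 ⟨fun _ _ _ h => h.elim, fun _ _ => trivial, fun h => h.elim,
    fun _ => ⟨0, fun _ _ => trivial⟩⟩

theorem isOpen_le_y (N : ℕ) : IsOpen {p : CombSpace.{u} | Le (y N) p} :=
  isOpen_iff.2 ⟨fun _ _ _ h => h.elim, fun h => h.elim, fun h => h.elim,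
    fun h => (ENat.natCast_ne_top N h).elim⟩

/-- The set of the `y n` with `N ≤ n`, including `y ⊤`. -/
def tail (N : ℕ) : Set CombSpace.{u} := {p | ∃ n : ℕ∞, N ≤ n ∧ p = y n}

theorem isOpen_tail (N : ℕ) : IsOpen (tail.{u} N) := by
  refine isOpen_iff.2 ⟨?_, ?_, ?_, fun _ => ⟨N, fun n hn => ⟨n, Nat.cast_le.2 hn, rfl⟩⟩⟩ <;>
    simp [tail]

/-- The set of the `y n` with `n` finite. -/
def finiteY : Set CombSpace.{u} := {p | ∃ n : ℕ, p = y n}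

theorem isOpen_finiteY : IsOpen finiteY.{u} := by
  refine isOpen_iff.2 ⟨?_, ?_, ?_, ?_⟩ <;> simp [finiteY]

/-- Each `↑ (d m)` is an intersection of open sets `↑ (d N)` with `N` finite, and `{y ⊤}` is the
intersection of the open tails. -/
theorem specLE_iff {p q : CombSpace.{u}} : SpecLE p q ↔ Le p q := by
  rw [specLE_iff_forall_isOpen]
  constructor
  · intro h
    cases p with
    | d m =>
      have key : ∀ N : ℕ, (N : ℕ∞) ≤ m → Le (d N) q := fun N hN => h _ (isOpen_le_d N) hN
      cases q with
      | d n => exact ENat.forall_natCast_le_iff_le.1 key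
      | x => exact key 0 (by simp)
      | y n => exact ENat.forall_natCast_le_iff_le.1 key
    | x => exact h _ isOpen_le_x trivial
    | y m =>
      induction m using ENat.recTopCoe with
      | coe m => exact h _ (isOpen_le_y m) rfl
      | top =>
        have key : ∀ N : ℕ, q ∈ tail N := fun N => h _ (isOpen_tail N) ⟨⊤, le_top, rfl⟩
        obtain ⟨n, -, rfl⟩ := key 0
        refine (top_unique (ENat.forall_natCast_le_iff_le.1 fun N _ => ?_)).symm
        obtain ⟨n', hn', h'⟩ := key N
        cases h'
        exact hn'
  · intro h U hU hp
    rw [isOpen_iff] at hU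
    cases p <;> cases q <;> simp only [Le] at h
    · exact (hU.1 _ _ h hp).1
    · exact (hU.1 _ _ h hp).2
    · exact hp
    · exact hU.2.1 hp _
    · exact h ▸ hp

instance : T0Space CombSpace.{u} := by
  refine ⟨fun p q h => ?_⟩
  have h₁ : Le p q := specLE_iff.1 (specLE_iff_specializes.2 h.specializes')
  have h₂ : Le q p := specLE_iff.1 (specLE_iff_specializes.2 h.specializes)
  cases p <;> cases q <;> simp only [Le] at h₁ h₂
  · rw [le_antisymm h₁ h₂]
  · rfl
  · rw [h₁]

theorem eq_y_top {p : CombSpace.{u}} (hd : ∀ n : ℕ, Le (d n) p) (hx : Le x p) : p = y ⊤ := by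
  cases p with
  | d n => exact hx.elim
  | x => exact (hd 0).elim
  | y n =>
    have : (⊤ : ℕ∞) ≤ n := ENat.forall_natCast_le_iff_le.1 fun N _ => hd N
    rw [top_unique this]

/-- A set in which every element has a strict upper bound consists of cofinally many `d n`. -/
theorem subset_range_d_and_cofinal {D : Set CombSpace.{u}} (hne : D.Nonempty)
    (h : ∀ p ∈ D, ∃ q ∈ D, Le p q ∧ ¬ Le q p) :
    (∀ p ∈ D, ∃ k : ℕ, p = d k) ∧ ∀ N : ℕ, ∃ n : ℕ, N ≤ n ∧ d n ∈ D := by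
  have hy : ∀ n, y n ∉ D := fun n hn => by
    obtain ⟨q, -, h₁, h₂⟩ := h _ hn
    cases q <;> simp only [Le] at h₁ h₂
    exact h₂ h₁.symm
  have hx : x ∉ D := fun hx => by
    obtain ⟨q, hq, h₁, h₂⟩ := h _ hx
    cases q <;> simp only [Le, not_true_eq_false] at h₁ h₂
    exact hy _ hq
  have hd : ∀ m, d m ∈ D → ∃ n, m < n ∧ d n ∈ D := fun m hm => by
    obtain ⟨q, hq, h₁, h₂⟩ := h _ hm
    cases q <;> simp only [Le] at h₁ h₂
    · exact ⟨_, not_le.1 h₂, hq⟩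
    · exact (hy _ hq).elim
  have hd' : ∀ m, d m ∈ D → ∃ k : ℕ, m = k := fun m hm => by
    obtain ⟨n, hn, -⟩ := hd m hm
    exact ⟨_, (ENat.natCast_toNat hn.ne_top).symm⟩
  have hD : ∀ p ∈ D, ∃ k : ℕ, p = d k := fun p hp => by
    cases p with
    | d m =>
      obtain ⟨k, rfl⟩ := hd' m hp
      exact ⟨k, rfl⟩
    | x => exact (hx hp).elim
    | y n => exact (hy n hp).elim
  refine ⟨hD, fun N => ?_⟩
  induction N with
  | zero =>
    obtain ⟨p, hp⟩ := hne
    obtain ⟨k, rfl⟩ := hD p hp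
    exact ⟨k, k.zero_le, hp⟩
  | succ N ih =>
    obtain ⟨m, hm, hmD⟩ := ih
    obtain ⟨n, hn, hnD⟩ := hd m hmD
    obtain ⟨k, rfl⟩ := hd' n hnD
    exact ⟨k, hm.trans_lt (Nat.cast_lt.1 hn), hnD⟩

/-- Without a greatest element, `D` is cofinal in the finite `d n`. The delicate case is `z = x`: an
open set around `y ⊤` contains almost all `y n`, hence `↑ (d n) ∩ ↑ x` for large `n`. -/
theorem isStrongDSpace : IsStrongDSpace CombSpace.{u} := by
  refine ⟨inferInstance, fun D hne hdir z U hU hsub => ?_⟩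
  by_cases hmax : ∃ g ∈ D, ∀ p ∈ D, SpecLE p g
  · obtain ⟨g, hg, hgD⟩ := hmax
    exact ⟨g, hg, fun q hq => hsub ⟨Set.mem_iInter₂.2 fun p hp => (hgD p hp).trans hq.1, hq.2⟩⟩
  -- A maximal element of a directed set is its greatest element.
  obtain ⟨hD, hcof⟩ := subset_range_d_and_cofinal hne fun p hp => by
    by_contra! hp'
    refine hmax ⟨p, hp, fun q hq => ?_⟩
    obtain ⟨r, hr, hpr, hqr⟩ := hdir p hp q hq
    exact hqr.trans (specLE_iff.2 (hp' r hr (specLE_iff.1 hpr)))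
  have hsub' {q : CombSpace.{u}} (hq : ∀ n : ℕ, Le (d n) q) (hzq : Le z q) : q ∈ U := by
    refine hsub ⟨Set.mem_iInter₂.2 fun p hp => ?_, specLE_iff.2 hzq⟩
    obtain ⟨k, rfl⟩ := hD p hp
    exact specLE_iff.2 (hq k)
  cases z with
  | d m =>
    obtain ⟨N, hN⟩ := hU.2.2.1 (hsub' (fun _ => le_top) le_top)
    obtain ⟨n, hn, hnD⟩ := hcof N
    exact ⟨_, hnD, fun q hq => specLE_iff_forall_isOpen.1 hq.1 U hU
      (hU.1 _ _ (Nat.cast_le.2 hn) hN).1⟩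
  | x =>
    have htop : y ⊤ ∈ U := hsub' (fun _ => le_top) trivial
    obtain ⟨N, hN⟩ := hU.2.2.2 htop
    obtain ⟨n, hn, hnD⟩ := hcof N
    refine ⟨_, hnD, fun q hq => ?_⟩
    have h₁ := specLE_iff.1 hq.1
    have h₂ := specLE_iff.1 hq.2
    cases q with
    | d k => exact h₂.elim
    | x => exact h₁.elim
    | y k =>
      induction k using ENat.recTopCoe with
      | top => exact htop
      | coe k => exact hN k (hn.trans (Nat.cast_le.1 h₁))
  | y m =>
    have hq_eq {q : CombSpace.{u}} (hq : SpecLE (y m) q) : q = y m := by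
      have := specLE_iff.1 hq
      cases q with
      | d k => exact this.elim
      | x => exact this.elim
      | y k => exact congrArg y this.symm
    induction m using ENat.recTopCoe with
    | top =>
      obtain ⟨n, -, hnD⟩ := hcof 0
      exact ⟨_, hnD, fun q hq => hq_eq hq.2 ▸ hsub' (fun _ => le_top) rfl⟩
    | coe m =>
      -- For `n > m`, `y m` is not above `d n`, so the intersection is empty.
      obtain ⟨n, hn, hnD⟩ := hcof (m + 1)
      refine ⟨_, hnD, fun q hq => ?_⟩
      obtain rfl := hq_eq hq.2
      exact absurd (Nat.cast_le.1 (specLE_iff.1 hq.1)) (by omega)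

/-- Characteristic maps of open sets, with values `d 0` and `y 0`. -/
noncomputable def indicator (V : Set CombSpace.{u}) (p : CombSpace.{u}) : CombSpace.{u} :=
  open Classical in if p ∈ V then y 0 else d 0

theorem continuous_indicator {V : Set CombSpace.{u}} (hV : IsOpen V) :
    Continuous (indicator V) := by
  refine ⟨fun U hU => ?_⟩
  by_cases h₁ : d 0 ∈ U
  · have h₂ : y 0 ∈ U := (hU.1 0 0 le_rfl h₁).2
    convert isOpen_univ
    ext p
    by_cases hp : p ∈ V <;> simp [indicator, hp, h₁, h₂]
  · by_cases h₂ : y 0 ∈ U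
    · convert hV
      ext p
      by_cases hp : p ∈ V <;> simp [indicator, hp, h₁, h₂]
    · convert isOpen_empty
      ext p
      by_cases hp : p ∈ V <;> simp [indicator, hp, h₁, h₂]

end CombSpace

/-! ### Non-reflectivity -/

open CombSpace in
theorem mainTheorem3 : ¬ IsReflectiveSubcategory isStrongD.{u} := by
  intro h
  let W : Type u := {p : CombSpace.{u} // p ≠ y ⊤}
  obtain ⟨R, _, η, hR, hη, huniv⟩ := exists_universal_map h W
  obtain ⟨hext, huniq⟩ := huniv CombSpace.{u} isStrongDSpace
  obtain ⟨f, hf, hfη⟩ := hext Subtype.val continuous_subtype_val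
  have hfη' (w : W) : f (η w) = w.1 := congrFun hfη w
  have hW {p q : W} (hpq : Le p.1 q.1) : SpecLE (η p) (η q) :=
    (specLE_iff_specializes.2
      ((subtype_specializes_iff _ _).2 (specLE_iff_specializes.1 (specLE_iff.2 hpq)))).map hη
  have hfR {p : W} {r : R} (hpr : SpecLE (η p) r) : Le p.1 (f r) := by
    rw [← hfη' p]
    exact specLE_iff.1 (hpr.map hf)
  let dW (n : ℕ) : W := ⟨d n, by simp⟩
  let yW (n : ℕ) : W := ⟨y n, by simp⟩
  let xW : W := ⟨x, by simp⟩
  -- `tail 0` and `finiteY` differ exactly at `y ⊤`, so this equality says that `f` misses `y ⊤`.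
  have hχ : indicator (tail 0) ∘ f = indicator finiteY ∘ f := by
    refine huniq _ _ ((continuous_indicator (isOpen_tail 0)).comp hf)
      ((continuous_indicator isOpen_finiteY).comp hf) ?_
    funext w
    have : w.1 ∈ tail 0 ↔ w.1 ∈ finiteY := by
      constructor
      · rintro ⟨n, -, hn⟩
        have hn' : n ≠ ⊤ := by
          rintro rfl
          exact w.2 hn
        exact ⟨n.toNat, by rw [ENat.natCast_toNat hn', hn]⟩
      · rintro ⟨n, hn⟩
        exact ⟨n, by simp, hn⟩
    simp only [Function.comp_apply, indicator]
    rw [hfη' w]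
    by_cases hw : w.1 ∈ finiteY
    · rw [if_pos (this.2 hw), if_pos hw]
    · rw [if_neg (mt this.1 hw), if_neg hw]
  have hdir : DirectedOn SpecLE (Set.range fun n => η (dW n)) := by
    rintro _ ⟨m, rfl⟩ _ ⟨n, rfl⟩
    refine ⟨_, ⟨max m n, rfl⟩, hW ?_, hW ?_⟩
    · exact Nat.cast_le (α := ℕ∞).2 (le_max_left m n)
    · exact Nat.cast_le (α := ℕ∞).2 (le_max_right m n)
  have hempty : (⋂ d ∈ Set.range fun n => η (dW n), specUpper d) ∩ specUpper (η xW) ⊆ ∅ := by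
    rintro r ⟨hr, hr'⟩
    have hfr : f r = y ⊤ :=
      eq_y_top (fun n => hfR (p := dW n) (Set.mem_iInter₂.1 hr _ ⟨n, rfl⟩)) (hfR (p := xW) hr')
    have := congrFun hχ r
    simp [indicator, hfr, tail, finiteY] at this
  obtain ⟨_, ⟨n, rfl⟩, hn⟩ := hR.exists_inter_subset _ (Set.range_nonempty _) hdir (η xW) ∅
    isOpen_empty hempty
  exact hn (a := η (yW n)) ⟨hW (le_refl (n : ℕ∞)), hW trivial⟩
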